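/- Let $H_1$ and $H_2$ be infinite-dimensional separable complex Hilbert spaces, and let $H_1\oplus H_2$ be their Hilbert space direct sum. A bounded operator $S$ on a Hilbert space $H$ is called absolutely norm attaining ($\mathcal{AN}$) if for every non-zero closed subspace $M$ of $H$ there is a unit vector $x\in M$ with $\|Sx\|=\|S|_M\|$. It is called positive, written $S\ge 0$, if $\langle Sx,x\rangle\ge 0$ for all $x\in H$. Its essential spectrum $\sigma_{ess}(S)$ is the set of all $\mu\in\mathbb{C}$ for which $S-\mu I$ is not Fredholm, where an operator is Fredholm if its range is closed and its kernel and the kernel of its adjoint are finite dimensional. Let $A_1\ge 0$ and $A_2\ge 0$ be bounded operators on $H_1$ and $H_2$ respectively, and let $X:H_2\to H_1$ be a bounded operator such that the block operator $$T=\begin{bmatrix} A_1 & X\\ X^* & A_2\end{bmatrix}$$ on $H_1\oplus H_2$ is positive. If $T$ is absolutely norm attaining, then $A_1$ and $A_2$ are absolutely norm attaining, $\sigma_{ess}(A_1)=\sigma_{ess}(A_2)$, and $X$ is compact. -/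

import Mathlib

universe u v

/-- A bounded operator `T` is norm attaining if `‖T x‖ = ‖T‖` for some unit vector `x`. -/
def IsNormAttaining {E : Type u} {F : Type v} [NormedAddCommGroup E] [NormedSpace ℂ E]
    [NormedAddCommGroup F] [NormedSpace ℂ F] (T : E →L[ℂ] F) : Prop :=
  ∃ x : E, ‖x‖ = 1 ∧ ‖T x‖ = ‖T‖

/-- A bounded operator is absolutely norm attaining (`AN`) if its restriction to every non-zero
closed subspace is norm attaining. -/
def IsAbsolutelyNormAttaining {E : Type u} {F : Type v} [NormedAddCommGroup E] [NormedSpace ℂ E]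
    [NormedAddCommGroup F] [NormedSpace ℂ F] (T : E →L[ℂ] F) : Prop :=
  ∀ M : Submodule ℂ E, IsClosed (M : Set E) → M ≠ ⊥ → IsNormAttaining (T ∘L M.subtypeL)

/-- On Hilbert spaces, a bounded operator is Fredholm exactly when its range is closed and the
kernels of the operator and of its adjoint are finite dimensional. -/
theorem isFredholm_iff_closed_range {E : Type u} {F : Type v}
    [NormedAddCommGroup E] [InnerProductSpace ℂ E] [CompleteSpace E]
    [NormedAddCommGroup F] [InnerProductSpace ℂ F] [CompleteSpace F] (T : E →L[ℂ] F) :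
    T.IsFredholm ↔ IsClosed (Set.range T) ∧ FiniteDimensional ℂ T.ker ∧
      FiniteDimensional ℂ (ContinuousLinearMap.adjoint T).ker := by
  have hr : ((T.range : Submodule ℂ F) : Set F) = Set.range T := by ext; simp
  have ho : (T.range)ᗮ = (ContinuousLinearMap.adjoint T).ker := T.orthogonal_range
  have hcompl (hc : IsClosed (T.range : Set F)) :
      IsCompl T.range (ContinuousLinearMap.adjoint T).ker := by
    have : CompleteSpace T.range := hc.completeSpace_coe
    rw [← ho]
    exact T.range.isCompl_orthogonal
  constructor
  · intro h
    have := h.finite_coker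
    exact ⟨hr ▸ h.isClosed_range, h.finite_ker,
      Module.Finite.equiv (Submodule.quotientEquivOfIsCompl _ _ (hcompl h.isClosed_range))⟩
  · rintro ⟨hc, hk, ha⟩
    rw [← hr] at hc
    refine ⟨?_, hc, hk, ?_, ?_⟩
    · have : CompleteSpace T.range := hc.completeSpace_coe
      have hs : Function.Surjective T.rangeRestrict := T.toLinearMap.surjective_rangeRestrict
      have ho : IsOpenMap T.rangeRestrict := T.rangeRestrict.isOpenMap hs
      exact T.toLinearMap.isStrictMap_iff_isOpenQuotientMap_rangeRestrict.2
        ⟨hs, T.rangeRestrict.continuous, ho⟩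
    · exact Module.Finite.equiv (Submodule.quotientEquivOfIsCompl _ _ (hcompl hc)).symm
    · have := hk
      exact Submodule.ClosedComplemented.of_finiteDimensional _

/-- The essential spectrum: all `μ` for which `T - μ I` is not a Fredholm operator. -/
def essentialSpectrum {H : Type u} [NormedAddCommGroup H] [InnerProductSpace ℂ H]
    (T : H →L[ℂ] H) : Set ℂ :=
  {μ : ℂ | ¬ (T - μ • ContinuousLinearMap.id ℂ H).IsFredholm}

/-- The operator `(x, y) ↦ (A x + B y, C x + D y)` on the Hilbert space direct sum `H₁ ⊕ H₂`,
that is, the operator with block matrix `[[A, B], [C, D]]`. -/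
noncomputable def blockOperator {H₁ : Type u} {H₂ : Type v}
    [NormedAddCommGroup H₁] [InnerProductSpace ℂ H₁]
    [NormedAddCommGroup H₂] [InnerProductSpace ℂ H₂]
    (A : H₁ →L[ℂ] H₁) (B : H₂ →L[ℂ] H₁) (C : H₁ →L[ℂ] H₂) (D : H₂ →L[ℂ] H₂) :
    WithLp 2 (H₁ × H₂) →L[ℂ] WithLp 2 (H₁ × H₂) :=
  (WithLp.prodContinuousLinearEquiv 2 ℂ H₁ H₂).symm.toContinuousLinearMap ∘L
    (((A.coprod B).prod (C.coprod D)) ∘L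
      (WithLp.prodContinuousLinearEquiv 2 ℂ H₁ H₂).toContinuousLinearMap)

/-! On an infinite-dimensional space, a positive operator is absolutely norm attaining exactly when
it has the form `a + K - F` with `a ≥ 0`, `K` positive compact and `F` of finite rank. This form
survives compression. If `J₁`, `J₂` are the inclusions of the summands, then `Aᵢ = Jᵢ† T Jᵢ = a +
Jᵢ† K Jᵢ - Jᵢ† F Jᵢ`, so each corner is again absolutely norm attaining. Each corner is also a
self-adjoint compact perturbation of the same scalar `a`, so both essential spectra are `{a}`. Since
`J₁† J₂ = 0`, the scalar disappears from `X = J₁† (K - F) J₂`, which is therefore compact.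

The forward half is `exists_eq_smul_add_sub_of_isAbsolutelyNormAttaining`: norm attainment on
invariant subspaces yields an eigenbasis, and eigenvalues accumulating from below, or at two points,
would give a subspace on which the norm is not attained. The converse half is
`isAbsolutelyNormAttaining_of_eq_smul_add_sub`. -/

open scoped InnerProductSpace ComplexOrder

/-! ### Norm attainment, eigenvectors and diagonalization -/

/-- A unit vector at which `S` attains its norm is an eigenvector of `S† S`. -/
theorem adjoint_apply_apply_of_norm_eq {E : Type u} {F : Type v}
    [NormedAddCommGroup E] [InnerProductSpace ℂ E] [CompleteSpace E]
    [NormedAddCommGroup F] [InnerProductSpace ℂ F] [CompleteSpace F]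
    (S : E →L[ℂ] F) {x : E} (hx : ‖x‖ = 1) (hS : ‖S x‖ = ‖S‖) :
    ContinuousLinearMap.adjoint S (S x) = ((‖S‖ ^ 2 : ℝ) : ℂ) • x := by
  have h1 : ‖ContinuousLinearMap.adjoint S (S x)‖ ≤ ‖S‖ ^ 2 := by
    calc _ ≤ ‖ContinuousLinearMap.adjoint S‖ * ‖S x‖ := ContinuousLinearMap.le_opNorm _ _
      _ = ‖S‖ ^ 2 := by rw [LinearIsometryEquiv.norm_map, hS, sq]
  have h2 : ⟪ContinuousLinearMap.adjoint S (S x), ((‖S‖ ^ 2 : ℝ) : ℂ) • x⟫_ℂ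
      = ((‖S‖ ^ 4 : ℝ) : ℂ) := by
    rw [inner_smul_right, ContinuousLinearMap.adjoint_inner_left, inner_self_eq_norm_sq_to_K, hS]
    push_cast
    simp only [Complex.coe_algebraMap]
    ring
  -- Equality case of Cauchy-Schwarz: `‖S†Sx - ‖S‖²x‖² ≤ ‖S‖⁴ - 2‖S‖⁴ + ‖S‖⁴ = 0`.
  have h3 := @norm_sub_sq ℂ E _ _ _ (ContinuousLinearMap.adjoint S (S x))
    (((‖S‖ ^ 2 : ℝ) : ℂ) • x)
  rw [h2, norm_smul, hx, Complex.norm_real, Real.norm_of_nonneg (by positivity)] at h3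
  simp only [RCLike.re_eq_complex_re, Complex.ofReal_re] at h3
  have h4 : ‖ContinuousLinearMap.adjoint S (S x)‖ ^ 2 ≤ (‖S‖ ^ 2) ^ 2 :=
    pow_le_pow_left₀ (norm_nonneg _) h1 2
  have h5 : ‖ContinuousLinearMap.adjoint S (S x) - ((‖S‖ ^ 2 : ℝ) : ℂ) • x‖ ^ 2 ≤ 0 := by
    rw [h3]; nlinarith
  exact sub_eq_zero.1 (norm_eq_zero.1 (pow_eq_zero_iff two_ne_zero |>.1
    (le_antisymm h5 (by positivity))))

/-- An `AN` operator cannot map an orthonormal family to an orthogonal family of vectors whose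
norms have no maximum. -/
theorem not_isAbsolutelyNormAttaining_of_orthonormal {E : Type u} {F : Type v}
    [NormedAddCommGroup E] [InnerProductSpace ℂ E] [CompleteSpace E]
    [NormedAddCommGroup F] [InnerProductSpace ℂ F] [CompleteSpace F]
    (T : E →L[ℂ] F) {κ : Type*} [Nonempty κ] {g : κ → E} (hg : Orthonormal ℂ g)
    (hT : Pairwise fun i j => ⟪T (g i), T (g j)⟫_ℂ = 0)
    (hlt : ∀ i, ∃ j, ‖T (g i)‖ < ‖T (g j)‖) : ¬ IsAbsolutelyNormAttaining T := by
  intro hAN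
  set M : Submodule ℂ E := (Submodule.span ℂ (Set.range g)).topologicalClosure with hM
  have hMc : IsClosed (M : Set E) := Submodule.isClosed_topologicalClosure _
  have hgM : ∀ i, g i ∈ M := fun i =>
    Submodule.le_topologicalClosure _ (Submodule.subset_span ⟨i, rfl⟩)
  have hM0 : M ≠ ⊥ := by
    obtain ⟨i⟩ := ‹Nonempty κ›
    exact fun h => hg.ne_zero i ((Submodule.mem_bot ℂ).1 (h ▸ hgM i))
  have : CompleteSpace M := hMc.completeSpace_coe
  obtain ⟨x, hx, hSx⟩ := hAN M hMc hM0
  set S := T ∘L M.subtypeL with hS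
  have hev := adjoint_apply_apply_of_norm_eq S hx hSx
  -- On `M`, each `g i` is an eigenvector of `S†S` with eigenvalue `‖T (g i)‖²`, strictly below the
  -- eigenvalue `‖S‖²` of `x` because the norms have no maximum. Hence `x` is orthogonal to every `g
  -- i`, yet lies in their closed span.
  have hgx : ∀ i, ⟪g i, (x : E)⟫_ℂ = 0 := by
    intro i
    let y : M := ⟨g i, hgM i⟩
    have hle : ∀ j, ‖T (g j)‖ ≤ ‖S‖ := fun j => by
      have := S.le_opNorm ⟨g j, hgM j⟩
      rwa [show ‖(⟨g j, hgM j⟩ : M)‖ = 1 from hg.1 j, mul_one] at this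
    have hlt' : ‖T (g i)‖ < ‖S‖ := by
      obtain ⟨j, hj⟩ := hlt i
      exact hj.trans_le (hle j)
    -- the vector `T† T g i - ‖T g i‖² g i` is orthogonal to `M`
    have horth : ∀ z ∈ M, ⟪ContinuousLinearMap.adjoint T (T (g i))
        - ((‖T (g i)‖ ^ 2 : ℝ) : ℂ) • g i, z⟫_ℂ = 0 := by
      intro z hz
      have hsub : M ≤ (innerSL ℂ (ContinuousLinearMap.adjoint T (T (g i))
          - ((‖T (g i)‖ ^ 2 : ℝ) : ℂ) • g i)).ker := by
        refine Submodule.topologicalClosure_minimal _ (Submodule.span_le.2 ?_)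
          (ContinuousLinearMap.isClosed_ker _)
        rintro _ ⟨j, rfl⟩
        simp only [SetLike.mem_coe, LinearMap.mem_ker, ContinuousLinearMap.coe_coe,
          innerSL_apply_apply]
        rw [inner_sub_left, ContinuousLinearMap.adjoint_inner_left, inner_smul_left]
        by_cases hij : i = j
        · subst hij
          rw [inner_self_eq_norm_sq_to_K, inner_self_eq_norm_sq_to_K, hg.1 i]
          simp
        · rw [hT hij, hg.2 hij]; simp
      have := hsub hz
      rwa [LinearMap.mem_ker, ContinuousLinearMap.coe_coe, innerSL_apply_apply] at this
    have h1 : ⟪y, ContinuousLinearMap.adjoint S (S x)⟫_ℂ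
        = ((‖T (g i)‖ ^ 2 : ℝ) : ℂ) * ⟪g i, (x : E)⟫_ℂ := by
      rw [ContinuousLinearMap.adjoint_inner_right]
      have := horth x x.2
      rw [inner_sub_left, ContinuousLinearMap.adjoint_inner_left, inner_smul_left, sub_eq_zero,
        Complex.conj_ofReal] at this
      exact this
    rw [hev, inner_smul_right] at h1
    have h2 : (((‖S‖ ^ 2 : ℝ) : ℂ) - ((‖T (g i)‖ ^ 2 : ℝ) : ℂ)) * ⟪g i, (x : E)⟫_ℂ = 0 := by
      rw [sub_mul, ← h1]; exact sub_self _
    refine (mul_eq_zero.1 h2).resolve_left ?_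
    rw [← Complex.ofReal_sub]
    refine mt Complex.ofReal_eq_zero.1 ?_
    have := norm_nonneg (T (g i))
    nlinarith
  have hx0 : M ≤ (innerSL ℂ (x : E)).ker := by
    refine Submodule.topologicalClosure_minimal _ (Submodule.span_le.2 ?_)
      (ContinuousLinearMap.isClosed_ker _)
    rintro _ ⟨j, rfl⟩
    exact inner_eq_zero_symm.1 (hgx j)
  have : (x : E) = 0 := inner_self_eq_zero.1 (hx0 x.2)
  rw [show x = 0 from Subtype.ext this] at hx
  simp at hx

/-- A positive `AN` operator on a non-trivial closed invariant subspace has an eigenvector. -/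
theorem exists_eigenvector_of_isAbsolutelyNormAttaining {E : Type u}
    [NormedAddCommGroup E] [InnerProductSpace ℂ E] [CompleteSpace E]
    {T : E →L[ℂ] E} (hT : T.IsPositive) (hAN : IsAbsolutelyNormAttaining T)
    (M : Submodule ℂ E) (hMc : IsClosed (M : Set E)) (hM0 : M ≠ ⊥) (hinv : ∀ x ∈ M, T x ∈ M) :
    ∃ μ : ℂ, ∃ x ∈ M, x ≠ 0 ∧ T x = μ • x := by
  have : CompleteSpace M := hMc.completeSpace_coe
  obtain ⟨x, hx, hSx⟩ := hAN M hMc hM0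
  set S := T ∘L M.subtypeL with hS
  have hev := adjoint_apply_apply_of_norm_eq S hx hSx
  have hx0 : (x : E) ≠ 0 := fun h => by
    rw [show x = 0 from Subtype.ext h] at hx
    simp at hx
  -- As `M` is invariant and `T` symmetric, `S†S` is the restriction of `T²` to `M`.
  have hTT : T (T x) = ((‖S‖ ^ 2 : ℝ) : ℂ) • (x : E) := by
    have key : T (T x) - ((‖S‖ ^ 2 : ℝ) : ℂ) • (x : E) = 0 := by
      have hmem : T (T x) - ((‖S‖ ^ 2 : ℝ) : ℂ) • (x : E) ∈ M :=
        M.sub_mem (hinv _ (hinv _ x.2)) (M.smul_mem _ x.2)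
      have h1 : ∀ z : M, ⟪(z : E), T (T x) - ((‖S‖ ^ 2 : ℝ) : ℂ) • (x : E)⟫_ℂ = 0 := by
        intro z
        have h2 : ⟪z, ContinuousLinearMap.adjoint S (S x)⟫_ℂ = ⟪T z, T x⟫_ℂ := by
          rw [ContinuousLinearMap.adjoint_inner_right]; rfl
        rw [hev] at h2
        rw [inner_sub_right, ← hT.inner_left_eq_inner_right, ← h2]
        exact sub_self _
      exact inner_self_eq_zero.1 (h1 ⟨_, hmem⟩)
    exact sub_eq_zero.1 key
  -- Factor `(T + ‖S‖)(T - ‖S‖)x = 0`: either the inner factor already kills `x`, or its value is an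
  -- eigenvector.
  by_cases hy : T x = (‖S‖ : ℂ) • (x : E)
  · exact ⟨_, x, x.2, hx0, hy⟩
  · refine ⟨-(‖S‖ : ℂ), T x - (‖S‖ : ℂ) • (x : E),
      M.sub_mem (hinv _ x.2) (M.smul_mem _ x.2), sub_ne_zero.2 hy, ?_⟩
    rw [map_sub, map_smul, hTT]
    push_cast
    module

/-- A positive `AN` operator is diagonalizable. -/
theorem exists_hilbertBasis_of_isAbsolutelyNormAttaining {E : Type u}
    [NormedAddCommGroup E] [InnerProductSpace ℂ E] [CompleteSpace E]
    {T : E →L[ℂ] E} (hT : T.IsPositive) (hAN : IsAbsolutelyNormAttaining T) :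
    ∃ (ι : Type u) (b : HilbertBasis ι ℂ E) (lam : ι → ℝ),
      (∀ i, 0 ≤ lam i) ∧ ∀ i, T (b i) = (lam i : ℂ) • b i := by
  classical
  let V : ℂ → Submodule ℂ E := fun μ => Module.End.eigenspace (T : Module.End ℂ E) μ
  have hVmem : ∀ μ x, x ∈ V μ ↔ T x = μ • x := fun μ x => Module.End.mem_eigenspace_iff
  have hVc : ∀ μ, IsClosed (V μ : Set E) := fun μ => by
    have : (V μ : Set E) = {x | T x = μ • x} := by ext x; exact hVmem μ x
    rw [this]
    exact isClosed_eq T.continuous (continuous_const_smul μ)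
  have hVcs : ∀ μ, CompleteSpace (V μ) := fun μ => (hVc μ).completeSpace_coe
  have hV : OrthogonalFamily ℂ (fun μ => V μ) fun μ => (V μ).subtypeₗᵢ :=
    hT.isSymmetric.orthogonalFamily_eigenspaces
  choose w c hc using fun μ => exists_hilbertBasis ℂ (V μ)
  have ho := hV.orthonormal_sigma_orthonormal (v_family := fun μ => c μ)
    fun μ => (c μ).orthonormal
  have hperp : ∀ x : E, (∀ μ, ∀ i : w μ, ⟪((c μ i : V μ) : E), x⟫_ℂ = 0) →
      ∀ μ, ∀ y ∈ V μ, ⟪y, x⟫_ℂ = 0 := by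
    intro x hx μ y hy
    rw [inner_eq_zero_symm]
    have h1 : (innerSL ℂ x ∘L (V μ).subtypeL) = 0 := by
      refine ContinuousLinearMap.ext_on
        (Submodule.dense_iff_topologicalClosure_eq_top.2 (c μ).dense_span) ?_
      rintro _ ⟨i, rfl⟩
      exact inner_eq_zero_symm.1 (hx μ i)
    exact congrArg (fun f => f (⟨y, hy⟩ : V μ)) h1
  have hbot : (Submodule.span ℂ (Set.range fun a : Σ μ, w μ =>
      (V a.1).subtypeₗᵢ (c a.1 a.2)))ᗮ = ⊥ := by
    set W := (Submodule.span ℂ (Set.range fun a : Σ μ, w μ =>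
      (V a.1).subtypeₗᵢ (c a.1 a.2)))ᗮ with hW
    have hWmem : ∀ x, x ∈ W ↔ ∀ μ, ∀ y ∈ V μ, ⟪y, x⟫_ℂ = 0 := by
      intro x
      constructor
      · intro hx
        exact hperp x fun μ i => hx _ (Submodule.subset_span ⟨⟨μ, i⟩, rfl⟩)
      · intro hx
        have : Submodule.span ℂ (Set.range fun a : Σ μ, w μ =>
            (V a.1).subtypeₗᵢ (c a.1 a.2)) ≤ (innerSL ℂ x).ker := by
          rw [Submodule.span_le]
          rintro _ ⟨a, rfl⟩
          exact inner_eq_zero_symm.1 (hx a.1 _ (c a.1 a.2).2)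
        exact fun y hy => inner_eq_zero_symm.1 (this hy)
    -- The complement `W` of all eigenspaces is closed and invariant. Were it non-zero, it would
    -- contain an eigenvector, which would be orthogonal to itself.
    by_contra hne
    obtain ⟨μ, x, hxW, hx0, hx⟩ := exists_eigenvector_of_isAbsolutelyNormAttaining hT hAN W
      (Submodule.isClosed_orthogonal _) hne (by
        intro x hx
        rw [hWmem] at hx ⊢
        intro μ y hy
        rw [← hT.inner_left_eq_inner_right, (hVmem μ y).1 hy, inner_smul_left, hx μ y hy,
          mul_zero])
    exact hx0 (inner_self_eq_zero.1 ((hWmem x).1 hxW μ x ((hVmem μ x).2 hx)))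
  let b := HilbertBasis.mkOfOrthogonalEqBot ho hbot
  have hb : ∀ a, b a = (V a.1).subtypeₗᵢ (c a.1 a.2) := fun a => by
    simp only [b, HilbertBasis.coe_mkOfOrthogonalEqBot]
  have hTb : ∀ a, T (b a) = a.1 • b a := fun a => by
    rw [hb]; exact (hVmem _ _).1 (c a.1 a.2).2
  have hpos : ∀ a : Σ μ, w μ, 0 ≤ a.1 := fun a => by
    have := hT.inner_nonneg_right (b a)
    rw [hTb, inner_smul_right, inner_self_eq_norm_sq_to_K, b.orthonormal.1 a] at this
    simpa using this
  refine ⟨_, b, fun a => a.1.re, fun a => (Complex.nonneg_iff.1 (hpos a)).1, fun a => ?_⟩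
  rw [hTb]
  congr 1
  exact Complex.ext rfl (Complex.nonneg_iff.1 (hpos a)).2.symm

/-! ### Accumulation of the eigenvalues -/

/-- The eigenvalues of a positive `AN` operator can only accumulate at one point, and only from
above. -/
theorem exists_finite_setOf_lt_of_isAbsolutelyNormAttaining {E : Type u}
    [NormedAddCommGroup E] [InnerProductSpace ℂ E] [CompleteSpace E]
    {T : E →L[ℂ] E} (hAN : IsAbsolutelyNormAttaining T) {ι : Type v} [Infinite ι]
    {b : ι → E} (hb : Orthonormal ℂ b) {lam : ι → ℝ} (h0 : ∀ i, 0 ≤ lam i)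
    (hTb : ∀ i, T (b i) = (lam i : ℂ) • b i) :
    ∃ a : ℝ, 0 ≤ a ∧ {i | lam i < a}.Finite ∧ ∀ ε > 0, {i | a + ε < lam i}.Finite := by
  have hnorm : ∀ i, ‖T (b i)‖ = lam i := fun i => by
    rw [hTb, norm_smul, hb.1 i, mul_one, Complex.norm_real, Real.norm_of_nonneg (h0 i)]
  have hinner : ∀ i j, i ≠ j → ⟪T (b i), T (b j)⟫_ℂ = 0 := fun i j hij => by
    rw [hTb, hTb, inner_smul_left, inner_smul_right, hb.2 hij, mul_zero, mul_zero]
  -- The infimum of `Z` is the limit superior of the eigenvalues: finitely many exceed it by any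
  -- fixed `ε`, infinitely many exceed anything smaller.
  set Z : Set ℝ := {t | {i | t < lam i}.Finite} with hZ
  have hZne : Z.Nonempty := ⟨‖T‖, by
    have : {i | ‖T‖ < lam i} = ∅ := by
      ext i
      simp only [Set.mem_ofPred_eq, Set.mem_empty_iff_false, iff_false, not_lt]
      have := T.le_opNorm (b i)
      rwa [hnorm, hb.1 i, mul_one] at this
    simp [hZ, this]⟩
  have hZ0 : ∀ t ∈ Z, 0 ≤ t := by
    intro t ht
    by_contra hlt
    refine Set.infinite_univ (α := ι) (Set.Finite.subset ht fun i _ => ?_)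
    exact (not_le.1 hlt).trans_le (h0 i)
  have hZb : BddBelow Z := ⟨0, hZ0⟩
  refine ⟨sInf Z, le_csInf hZne hZ0, ?_, ?_⟩
  swap
  · intro ε hε
    obtain ⟨t, ht, hlt⟩ := exists_lt_of_csInf_lt hZne (lt_add_of_pos_right (sInf Z) hε)
    exact Set.Finite.subset ht fun i hi => hlt.trans hi
  have hinf : ∀ t < sInf Z, {i | t < lam i}.Infinite := fun t ht hfin =>
    not_lt.2 (csInf_le hZb hfin) ht
  set α := sInf Z with hα
  by_contra hI
  by_cases hβ : ∃ β < α, {i | lam i ≤ β}.Infinite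
  · obtain ⟨β, hβα, hβi⟩ := hβ
    obtain ⟨γ, hβγ, hγα⟩ := exists_between hβα
    have hγi := hinf γ hγα
    let e := hβi.natEmbedding
    let f := hγi.natEmbedding
    have he : ∀ n, lam (e n) ≤ β := fun n => (e n).2
    have hf : ∀ n, γ < lam (f n) := fun n => (f n).2
    have hef : ∀ n m, (e n : ι) ≠ f m := fun n m h => by
      have h1 := he n
      have h2 := hf m
      rw [h] at h1
      linarith
    have hee : ∀ n m, n ≠ m → (e n : ι) ≠ e m := fun n m h h' => h (e.injective (Subtype.ext h'))
    have hff : ∀ n m, n ≠ m → (f n : ι) ≠ f m := fun n m h h' => h (f.injective (Subtype.ext h'))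
    have hβ0 : 0 ≤ β := (h0 _).trans (he 0)
    -- Infinitely many eigenvalues are at most `β` and infinitely many exceed `γ`. Pairing them off,
    -- a unit vector in the `n`-th plane can be given any squared image norm in `[β², γ²]`. The
    -- targets `w n` increase strictly from `β²` towards `γ²`, so no maximum is reached.
    let w : ℕ → ℝ := fun n => γ ^ 2 - (γ ^ 2 - β ^ 2) / (n + 1)
    have hd : 0 < γ ^ 2 - β ^ 2 := by nlinarith
    have hw1 : ∀ n, β ^ 2 ≤ w n := fun n => by
      have : (γ ^ 2 - β ^ 2) / (n + 1) ≤ γ ^ 2 - β ^ 2 :=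
        div_le_self hd.le (by have : (0:ℝ) ≤ n := n.cast_nonneg; linarith)
      simp only [w]; linarith
    have hw2 : ∀ n, w n ≤ γ ^ 2 := fun n => by
      have : 0 ≤ (γ ^ 2 - β ^ 2) / ((n:ℝ) + 1) := by positivity
      simp only [w]; linarith
    have hw3 : ∀ n, w n < w (n + 1) := fun n => by
      have : (γ ^ 2 - β ^ 2) / ((n + 1 : ℕ) + 1 : ℝ) < (γ ^ 2 - β ^ 2) / ((n:ℝ) + 1) := by
        apply div_lt_div_of_pos_left hd (by positivity)
        push_cast; linarith
      simp only [w]; linarith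
    have hcs : ∀ n, ∃ c s : ℝ, c ^ 2 + s ^ 2 = 1 ∧
        c ^ 2 * lam (e n) ^ 2 + s ^ 2 * lam (f n) ^ 2 = w n := by
      intro n
      have h1 : lam (e n) ^ 2 ≤ w n := (pow_le_pow_left₀ (h0 _) (he n) 2).trans (hw1 n)
      have h2 : w n < lam (f n) ^ 2 :=
        (hw2 n).trans_lt (pow_lt_pow_left₀ (hf n) (by linarith) two_ne_zero)
      have hD : 0 < lam (f n) ^ 2 - lam (e n) ^ 2 := by linarith
      refine ⟨√((lam (f n) ^ 2 - w n) / (lam (f n) ^ 2 - lam (e n) ^ 2)),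
        √((w n - lam (e n) ^ 2) / (lam (f n) ^ 2 - lam (e n) ^ 2)), ?_, ?_⟩
      all_goals
        rw [Real.sq_sqrt (div_nonneg (by linarith) hD.le),
          Real.sq_sqrt (div_nonneg (by linarith) hD.le)]
        field_simp
        ring
    choose c s hcs1 hcsw using hcs
    let g : ℕ → E := fun n => (c n : ℂ) • b (e n) + (s n : ℂ) • b (f n)
    have hTg : ∀ n, T (g n) = (c n : ℂ) • T (b (e n)) + (s n : ℂ) • T (b (f n)) := fun n => by
      simp only [g, map_add, map_smul]
    have hsq : ∀ n, ‖T (g n)‖ ^ 2 = w n := fun n => by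
      have h1 : ⟪(c n : ℂ) • T (b (e n)), (s n : ℂ) • T (b (f n))⟫_ℂ = 0 := by
        rw [inner_smul_left, inner_smul_right, hinner _ _ (hef n n), mul_zero, mul_zero]
      have h2 := norm_add_sq_eq_norm_sq_add_norm_sq_of_inner_eq_zero _ _ h1
      rw [← hTg, norm_smul, norm_smul, hnorm, hnorm, Complex.norm_real, Complex.norm_real] at h2
      rw [sq, h2, ← hcsw, ← sq_abs (c n), ← sq_abs (s n), Real.norm_eq_abs, Real.norm_eq_abs]
      ring
    have hg : Orthonormal ℂ g := by
      refine ⟨fun n => ?_, fun n m hnm => ?_⟩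
      · have h1 : ⟪(c n : ℂ) • b (e n), (s n : ℂ) • b (f n)⟫_ℂ = 0 := by
          rw [inner_smul_left, inner_smul_right, hb.2 (hef n n), mul_zero, mul_zero]
        have h2 := norm_add_sq_eq_norm_sq_add_norm_sq_of_inner_eq_zero _ _ h1
        rw [norm_smul, norm_smul, hb.1, hb.1, Complex.norm_real, Complex.norm_real, mul_one,
          mul_one, Real.norm_eq_abs, Real.norm_eq_abs, abs_mul_abs_self, abs_mul_abs_self,
          ← sq, ← sq, ← sq, hcs1] at h2
        exact (pow_eq_one_iff_of_nonneg (norm_nonneg _) two_ne_zero).1 h2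
      · simp only [g, inner_add_left, inner_add_right, inner_smul_left, inner_smul_right,
          hb.2 (hee n m hnm), hb.2 (hff n m hnm), hb.2 (hef n m), hb.2 (hef m n).symm, mul_zero,
          add_zero]
    refine not_isAbsolutelyNormAttaining_of_orthonormal T hg (fun n m hnm => ?_)
      (fun n => ⟨n + 1, ?_⟩) hAN
    · simp only [hTg, inner_add_left, inner_add_right, inner_smul_left, inner_smul_right,
          hinner _ _ (hee n m hnm), hinner _ _ (hff n m hnm), hinner _ _ (hef n m),
          hinner _ _ (hef m n).symm, mul_zero, add_zero]
    · refine lt_of_pow_lt_pow_left₀ 2 (norm_nonneg _) ?_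
      rw [hsq, hsq]
      exact hw3 n
  -- Here only finitely many eigenvalues lie below any `β < α`, so the infinitely many below `α`
  -- have no maximum and their eigenvectors need no mixing.
  · push Not at hβ
    have hne : Nonempty {i | lam i < α} := by
      obtain ⟨i, hi⟩ := Set.Infinite.nonempty hI
      exact ⟨⟨i, hi⟩⟩
    refine not_isAbsolutelyNormAttaining_of_orthonormal T
      (g := fun i : {i | lam i < α} => b i) (hb.comp _ Subtype.val_injective)
      (fun i j hij => hinner _ _ fun h => hij (Subtype.ext h)) (fun i => ?_) hAN
    obtain ⟨j, hj, hj'⟩ := (Set.Infinite.sdiff hI (hβ (lam i) i.2)).nonempty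
    refine ⟨⟨j, hj⟩, ?_⟩
    rw [hnorm, hnorm]
    exact not_le.1 hj'

/-! ### Operators diagonal in a Hilbert basis -/

section Diagonal

variable {E : Type u} [NormedAddCommGroup E] [InnerProductSpace ℂ E]
  {ι : Type v} (b : HilbertBasis ι ℂ E)

theorem HilbertBasis.inner_apply_of_diagonal {D : E →L[ℂ] E} {d : ι → ℂ}
    (hD : ∀ i, D (b i) = d i • b i) (i : ι) (x : E) : ⟪b i, D x⟫_ℂ = d i * ⟪b i, x⟫_ℂ := by
  have h : innerSL ℂ (b i) ∘L D = d i • innerSL ℂ (b i) := by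
    refine ContinuousLinearMap.ext_on
      (Submodule.dense_iff_topologicalClosure_eq_top.2 b.dense_span) ?_
    rintro _ ⟨j, rfl⟩
    simp only [ContinuousLinearMap.comp_apply, innerSL_apply_apply, hD, inner_smul_right,
      smul_apply, smul_eq_mul]
    by_cases hij : i = j
    · rw [hij]
    · rw [b.orthonormal.2 hij, mul_zero, mul_zero]
  exact congrArg (fun f => f x) h

theorem HilbertBasis.hasSum_norm_inner_sq (x : E) :
    HasSum (fun i => ‖⟪b i, x⟫_ℂ‖ ^ 2) (‖x‖ ^ 2) := by
  have h := (b.hasSum_inner_mul_inner x x).mapL Complex.reCLM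
  convert! h using 1
  · ext i
    rw [← inner_conj_symm x (b i), ← Complex.normSq_eq_conj_mul_self, Complex.reCLM_apply,
      Complex.ofReal_re, Complex.normSq_eq_norm_sq]
  · rw [inner_self_eq_norm_sq_to_K]
    simp [← Complex.ofReal_pow]

/-- By Parseval, `‖D x‖² = ∑ ‖d i‖² ‖⟪b i, x⟫‖²`. This turns decay of the eigenvalues into norm
convergence of truncations. -/
theorem HilbertBasis.opNorm_le_of_diagonal {D : E →L[ℂ] E} {d : ι → ℂ}
    (hD : ∀ i, D (b i) = d i • b i) {C : ℝ} (hC : 0 ≤ C) (hd : ∀ i, ‖d i‖ ≤ C) : ‖D‖ ≤ C := by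
  refine D.opNorm_le_bound hC fun x => ?_
  refine le_of_sq_le_sq ?_ (by positivity)
  rw [mul_pow]
  refine hasSum_le (fun i => ?_) (b.hasSum_norm_inner_sq (D x))
    ((b.hasSum_norm_inner_sq x).mul_left (C ^ 2))
  rw [b.inner_apply_of_diagonal hD, norm_mul, mul_pow]
  gcongr
  exact hd i

theorem HilbertBasis.isPositive_of_diagonal {D : E →L[ℂ] E} {d : ι → ℝ}
    (hD : ∀ i, D (b i) = (d i : ℂ) • b i) (hd : ∀ i, 0 ≤ d i) : D.IsPositive := by
  have h : ∀ x y, ⟪y, D x⟫_ℂ = ∑' i, (d i : ℂ) * (⟪y, b i⟫_ℂ * ⟪b i, x⟫_ℂ) := fun x y => by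
    rw [← b.tsum_inner_mul_inner]
    refine tsum_congr fun i => ?_
    rw [b.inner_apply_of_diagonal hD]
    ring
  have hpos : ∀ x, 0 ≤ ⟪x, D x⟫_ℂ := fun x => by
    rw [h]
    refine tsum_nonneg fun i => mul_nonneg (by exact_mod_cast hd i) ?_
    rw [← inner_conj_symm x (b i), ← Complex.normSq_eq_conj_mul_self]
    exact_mod_cast Complex.normSq_nonneg _
  rw [← ContinuousLinearMap.isPositive_toLinearMap_iff, LinearMap.isPositive_iff_complex]
  intro x
  have h1 : 0 ≤ ⟪D x, x⟫_ℂ := by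
    rw [← inner_conj_symm]
    exact star_nonneg_iff.2 (hpos x)
  obtain ⟨h2, h3⟩ := Complex.nonneg_iff.1 h1
  exact ⟨Complex.ext rfl h3, h2⟩

/-- The operator that multiplies `b i` by `d i` for `i ∈ s` and kills the other basis vectors. -/
noncomputable def HilbertBasis.finiteDiagonal (s : Finset ι) (d : ι → ℂ) : E →L[ℂ] E :=
  ∑ i ∈ s, d i • (innerSL ℂ (b i)).smulRight (b i)

theorem HilbertBasis.finiteDiagonal_apply [DecidableEq ι] (s : Finset ι) (d : ι → ℂ) (j : ι) :
    b.finiteDiagonal s d (b j) = (if j ∈ s then d j else 0) • b j := by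
  have h : ∀ i, ⟪b i, b j⟫_ℂ = if i = j then 1 else 0 := fun i =>
    orthonormal_iff_ite.1 b.orthonormal i j
  simp [finiteDiagonal, h, ite_smul]

theorem HilbertBasis.finiteDimensional_range_finiteDiagonal (s : Finset ι) (d : ι → ℂ) :
    FiniteDimensional ℂ (b.finiteDiagonal s d).range := by
  classical
  have hle : (b.finiteDiagonal s d).range ≤ Submodule.span ℂ ((s.image b : Finset E) : Set E) := by
    rintro _ ⟨x, rfl⟩
    simp only [finiteDiagonal, ContinuousLinearMap.coe_coe, sum_apply]
    refine Submodule.sum_mem _ fun i hi => ?_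
    exact Submodule.smul_mem _ _ (Submodule.smul_mem _ _
      (Submodule.subset_span (by simpa using ⟨i, hi, rfl⟩)))
  exact Submodule.finiteDimensional_of_le hle

end Diagonal

/-! ### The decomposition `a + K - F` -/

/-- A bounded operator of finite rank is compact. -/
theorem isCompactOperator_of_finiteDimensional_range {E : Type u} {F : Type v}
    [NormedAddCommGroup E] [NormedSpace ℂ E] [NormedAddCommGroup F] [NormedSpace ℂ F]
    (T : E →L[ℂ] F) [FiniteDimensional ℂ T.range] : IsCompactOperator T := by
  have : ProperSpace T.range := FiniteDimensional.proper ℂ T.range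
  have h : IsCompactOperator T.rangeRestrict :=
    isCompactOperator_of_locallyCompactSpace_dom T.rangeRestrict
  exact h.clm_comp T.range.subtypeL

/-- A positive `AN` operator on an infinite dimensional space is a non-negative multiple of the
identity plus a positive compact operator minus an operator of finite rank. -/
theorem exists_eq_smul_add_sub_of_isAbsolutelyNormAttaining {E : Type u}
    [NormedAddCommGroup E] [InnerProductSpace ℂ E] [CompleteSpace E]
    (hE : ¬ FiniteDimensional ℂ E)
    {T : E →L[ℂ] E} (hT : T.IsPositive) (hAN : IsAbsolutelyNormAttaining T) :
    ∃ (a : ℝ) (K F : E →L[ℂ] E), 0 ≤ a ∧ K.IsPositive ∧ IsCompactOperator K ∧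
      FiniteDimensional ℂ F.range ∧ T = (a : ℂ) • ContinuousLinearMap.id ℂ E + K - F := by
  classical
  obtain ⟨ι, b, lam, h0, hTb⟩ := exists_hilbertBasis_of_isAbsolutelyNormAttaining hT hAN
  have : Infinite ι := by
    by_contra hι
    rw [not_infinite_iff_finite] at hι
    have := Fintype.ofFinite ι
    exact hE (Module.Basis.finiteDimensional_of_finite b.toOrthonormalBasis.toBasis)
  obtain ⟨a, ha, hfin, hε⟩ :=
    exists_finite_setOf_lt_of_isAbsolutelyNormAttaining hAN b.orthonormal h0 hTb
  -- `F` lifts the finitely many eigenvalues below `a` up to `a`, so that `K` is diagonal with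
  -- entries `max (lam i - a) 0`.
  let F := b.finiteDiagonal hfin.toFinset fun i => ((a - lam i : ℝ) : ℂ)
  let K := T - (a : ℂ) • ContinuousLinearMap.id ℂ E + F
  have hK : ∀ i, K (b i) = ((max (lam i - a) 0 : ℝ) : ℂ) • b i := fun i => by
    simp only [K, F, add_apply, sub_apply, hTb,
      HilbertBasis.finiteDiagonal_apply, smul_apply,
      ContinuousLinearMap.id_apply, Set.Finite.mem_toFinset, Set.mem_ofPred_eq]
    rw [← sub_smul, ← add_smul]
    congr 1
    split_ifs with h
    · rw [max_eq_right (by linarith)]; push_cast; ring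
    · rw [max_eq_left (by linarith)]; push_cast; ring
  refine ⟨a, K, F, ha, b.isPositive_of_diagonal hK fun i => le_max_right _ _, ?_,
    b.finiteDimensional_range_finiteDiagonal _ _, by simp only [K]; abel⟩
  -- Finite-rank truncations of `K` to eigenvalues above `a + 1/(n+1)`; the discarded entries are at
  -- most `1/(n+1)`.
  let G : ℕ → E →L[ℂ] E := fun n => b.finiteDiagonal
    (hε (1 / ((n : ℝ) + 1)) (by positivity)).toFinset fun i => ((lam i - a : ℝ) : ℂ)
  have hle : ∀ n, ‖G n - K‖ ≤ 1 / ((n : ℝ) + 1) := fun n => by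
    have hn : 0 < 1 / ((n : ℝ) + 1) := by positivity
    refine b.opNorm_le_of_diagonal (d := fun i => (((if a + 1 / ((n : ℝ) + 1) < lam i then
      lam i - a else 0) - max (lam i - a) 0 : ℝ) : ℂ)) (fun i => ?_) hn.le fun i => ?_
    · simp only [G, sub_apply, hK, HilbertBasis.finiteDiagonal_apply,
        Set.Finite.mem_toFinset, Set.mem_ofPred_eq]
      rw [← sub_smul]
      congr 1
      split_ifs <;> push_cast <;> ring
    · rw [Complex.norm_real, Real.norm_eq_abs, abs_le]
      split_ifs with h
      · rw [max_eq_left (by linarith)]; constructor <;> linarith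
      · rcases le_total (lam i - a) 0 with h' | h'
        · rw [max_eq_right h']; constructor <;> linarith
        · rw [max_eq_left h']; constructor <;> linarith
  refine isCompactOperator_of_tendsto (l := Filter.atTop) (F := G) ?_
    (Filter.Eventually.of_forall fun n => ?_)
  · rw [tendsto_iff_norm_sub_tendsto_zero]
    exact squeeze_zero (fun n => norm_nonneg _) hle tendsto_one_div_add_atTop_nhds_zero_nat
  · have : FiniteDimensional ℂ (G n).range := b.finiteDimensional_range_finiteDiagonal _ _
    exact isCompactOperator_of_finiteDimensional_range (G n)

/-! ### From the decomposition back to norm attainment -/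

/-- If `S† S - c` is compact and `‖S‖² ≠ c`, then `S` attains its norm. -/
theorem isNormAttaining_of_isCompactOperator {E : Type u} {F : Type v} [Nontrivial E]
    [NormedAddCommGroup E] [InnerProductSpace ℂ E] [CompleteSpace E]
    [NormedAddCommGroup F] [InnerProductSpace ℂ F] [CompleteSpace F]
    (S : E →L[ℂ] F) (c : ℝ) (hc : ‖S‖ ^ 2 ≠ c)
    (hS : IsCompactOperator (ContinuousLinearMap.adjoint S ∘L S
      - (c : ℂ) • ContinuousLinearMap.id ℂ E)) : IsNormAttaining S := by
  set B := ContinuousLinearMap.adjoint S ∘L S with hB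
  have hB0 : 0 ≤ B := (ContinuousLinearMap.nonneg_iff_isPositive _).2
    (ContinuousLinearMap.isPositive_adjoint_comp_self S)
  have hBn : ‖B‖ = ‖S‖ ^ 2 := by
    rw [hB, ContinuousLinearMap.norm_adjoint_comp_self, sq]
  have hspec : (‖S‖ ^ 2 : ℝ) ∈ spectrum ℝ B := hBn ▸ CStarAlgebra.norm_mem_spectrum_of_nonneg hB0
  have hspec' : ((‖S‖ ^ 2 : ℝ) : ℂ) ∈ spectrum ℂ B := by
    have := spectrum.algebraMap_mem ℂ hspec
    simpa using this
  have hspec2 : ((‖S‖ ^ 2 : ℝ) : ℂ) - (c : ℂ) ∈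
      spectrum ℂ (B - (c : ℂ) • ContinuousLinearMap.id ℂ E) := by
    rw [spectrum.mem_iff] at hspec' ⊢
    convert! hspec' using 2
    rw [map_sub, Algebra.algebraMap_eq_smul_one, Algebra.algebraMap_eq_smul_one]
    simp only [← ContinuousLinearMap.one_def]
    abel
  have hne : ((‖S‖ ^ 2 : ℝ) : ℂ) - (c : ℂ) ≠ 0 := by
    rw [← Complex.ofReal_sub]
    exact mt Complex.ofReal_eq_zero.1 (sub_ne_zero.2 hc)
  -- Fredholm alternative: a non-zero spectral value of a compact operator is an eigenvalue.
  obtain ⟨x, hx⟩ := ((hS.hasEigenvalue_iff_mem_spectrum hne).2 hspec2).exists_hasEigenvector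
  have hx1 := hx.apply_eq_smul
  have hBx : B x = ((‖S‖ ^ 2 : ℝ) : ℂ) • x := by
    have h : B x - (c : ℂ) • x = (((‖S‖ ^ 2 : ℝ) : ℂ) - (c : ℂ)) • x := hx1
    rw [sub_smul] at h
    exact sub_left_injective h
  have hx0 : ‖x‖ ≠ 0 := norm_ne_zero_iff.2 hx.2
  have hSx : ‖S x‖ = ‖S‖ * ‖x‖ := by
    have h1 : ⟪B x, x⟫_ℂ = ⟪S x, S x⟫_ℂ := ContinuousLinearMap.adjoint_inner_left S x (S x)
    rw [hBx, inner_smul_left, Complex.conj_ofReal, inner_self_eq_norm_sq_to_K,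
      inner_self_eq_norm_sq_to_K] at h1
    have h2 : ‖S‖ ^ 2 * ‖x‖ ^ 2 = ‖S x‖ ^ 2 := by
      apply Complex.ofReal_injective
      simpa using h1
    rw [← mul_pow] at h2
    exact ((pow_left_inj₀ (by positivity) (by positivity) two_ne_zero).1 h2).symm
  refine ⟨((‖x‖⁻¹ : ℝ) : ℂ) • x, ?_, ?_⟩
  · rw [norm_smul, Complex.norm_real, norm_inv, norm_norm, inv_mul_cancel₀ hx0]
  · rw [map_smul, norm_smul, hSx, Complex.norm_real, norm_inv, norm_norm]
    field_simp

/-- A self-adjoint operator which is a non-negative multiple of the identity plus a positive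
compact operator minus an operator of finite rank is `AN`. -/
theorem isAbsolutelyNormAttaining_of_eq_smul_add_sub {E : Type u}
    [NormedAddCommGroup E] [InnerProductSpace ℂ E] [CompleteSpace E]
    {T K F : E →L[ℂ] E} {a : ℝ} (ha : 0 ≤ a) (hTs : IsSelfAdjoint T) (hK : K.IsPositive)
    (hKc : IsCompactOperator K) [FiniteDimensional ℂ F.range]
    (hT : T = (a : ℂ) • ContinuousLinearMap.id ℂ E + K - F) : IsAbsolutelyNormAttaining T := by
  intro M hMc hM0
  have : CompleteSpace M := hMc.completeSpace_coe
  have : Nontrivial M := Submodule.nontrivial_iff_ne_bot.2 hM0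
  set S := T ∘L M.subtypeL with hS
  by_cases hfd : FiniteDimensional ℂ M
  · have : ProperSpace M := FiniteDimensional.proper ℂ M
    -- On a finite-dimensional `M` everything is compact; `-1` merely differs from `‖S‖²`.
    refine isNormAttaining_of_isCompactOperator S (-1) (by have := sq_nonneg ‖S‖; linarith) ?_
    exact isCompactOperator_of_locallyCompactSpace_dom _
  by_cases hSa : ‖S‖ ^ 2 = a ^ 2
  · have hSa' : ‖S‖ = a := (sq_eq_sq₀ (norm_nonneg S) ha).1 hSa
    -- `M` is infinite-dimensional, so it meets the kernel of `F`. There `‖T x‖² = a² + 2a⟪x, K x⟫ +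
    -- ‖K x‖² ≥ a²`, and the bound `‖S‖ = a` is attained.
    obtain ⟨x, hx1, hFx⟩ : ∃ x : M, ‖x‖ = 1 ∧ F x = 0 := by
      have hker : (F ∘L M.subtypeL).ker ≠ ⊥ := by
        intro h
        refine hfd (FiniteDimensional.of_injective
          (F.toLinearMap.rangeRestrict ∘ₗ M.subtype) ?_)
        rw [← LinearMap.ker_eq_bot, eq_bot_iff, ← h]
        intro y hy
        exact congrArg Subtype.val (LinearMap.mem_ker.1 hy)
      obtain ⟨y, hy, hy0⟩ := Submodule.exists_mem_ne_zero_of_ne_bot hker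
      have hy0' : ‖y‖ ≠ 0 := norm_ne_zero_iff.2 hy0
      refine ⟨((‖y‖⁻¹ : ℝ) : ℂ) • y, ?_, ?_⟩
      · rw [norm_smul, Complex.norm_real, norm_inv, norm_norm, inv_mul_cancel₀ hy0']
      · have : F (y : E) = 0 := hy
        rw [Submodule.coe_smul, map_smul, this, smul_zero]
    refine ⟨x, hx1, le_antisymm ?_ ?_⟩
    · have := S.le_opNorm x
      rwa [hx1, mul_one] at this
    · have hx1' : ‖(x : E)‖ = 1 := hx1
      have hSx : S x = (a : ℂ) • (x : E) + K x := by
        simp [hS, hT, hFx]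
      have h1 := @norm_add_sq ℂ E _ _ _ ((a : ℂ) • (x : E)) (K x)
      rw [← hSx, inner_smul_left, Complex.conj_ofReal, norm_smul, hx1', Complex.norm_real,
        Real.norm_of_nonneg ha, RCLike.re_eq_complex_re, Complex.re_ofReal_mul] at h1
      have h2 : 0 ≤ (⟪(x : E), K x⟫_ℂ).re := hK.re_inner_nonneg_right x
      rw [hSa']
      refine le_of_sq_le_sq ?_ (norm_nonneg _)
      have := mul_nonneg ha h2
      have := sq_nonneg ‖K x‖
      rw [h1]
      linarith
  · refine isNormAttaining_of_isCompactOperator S (a ^ 2) hSa ?_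
    have hC : IsCompactOperator (K - F) :=
      hKc.sub (isCompactOperator_of_finiteDimensional_range F)
    set C := K - F with hCdef
    have hTC : T = (a : ℂ) • ContinuousLinearMap.id ℂ E + C := by rw [hT, hCdef]; abel
    -- From `T = a + C` comes `T² = a² + aC + TC`; compressing to `M` leaves a compact perturbation
    -- of `a²`.
    have hadj : ContinuousLinearMap.adjoint S ∘L S - ((a ^ 2 : ℝ) : ℂ) • ContinuousLinearMap.id ℂ M
        = ContinuousLinearMap.adjoint M.subtypeL ∘L
          ((a : ℂ) • C + T ∘L C) ∘L M.subtypeL := by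
      ext1 x
      refine ext_inner_left ℂ fun y => ?_
      simp only [sub_apply, ContinuousLinearMap.comp_apply, inner_sub_right,
        ContinuousLinearMap.adjoint_inner_right, smul_apply,
        ContinuousLinearMap.id_apply, add_apply]
      have h1 : ⟪S y, S x⟫_ℂ = ⟪(y : E), T (T x)⟫_ℂ :=
        hTs.isSymmetric (y : E) (T x)
      have h2 : T (T x) = ((a ^ 2 : ℝ) : ℂ) • (x : E) + ((a : ℂ) • C x + T (C x)) := by
        have h3 : T (x : E) = (a : ℂ) • (x : E) + C x := by
          rw [hTC]; rfl
        rw [h3, map_add, map_smul, h3]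
        push_cast
        module
      rw [h1, h2, inner_add_right]
      exact add_sub_cancel_left _ _
    rw [hadj]
    exact ((hC.smul (a : ℂ)).add (hC.clm_comp T)).comp_clm M.subtypeL |>.clm_comp
      (ContinuousLinearMap.adjoint M.subtypeL)

/-! ### Essential spectrum -/

/-- A compact operator on an infinite dimensional space is not Fredholm. -/
theorem not_isFredholm_of_isCompactOperator {E : Type u}
    [NormedAddCommGroup E] [InnerProductSpace ℂ E] [CompleteSpace E]
    (hE : ¬ FiniteDimensional ℂ E) {C : E →L[ℂ] E} (hC : IsCompactOperator C) :
    ¬ C.IsFredholm := by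
  intro h
  -- With a parametrix `V`, the identity is `V C` minus a finite-rank operator, hence compact.
  obtain ⟨V, hV, -⟩ := h.exists_isQuasiInverse
  have hr : (V.toLinearMap ∘ₗ C.toLinearMap - LinearMap.id).HasNoetherianRange :=
    LinearMap.FiniteRangeSetoid.equiv_iff_hasNoetherianRange.1 hV
  have : FiniteDimensional ℂ (V ∘L C - ContinuousLinearMap.id ℂ E).range :=
    Module.Finite.iff_fg.2 hr.hasFiniteRange
  have h1 := isCompactOperator_of_finiteDimensional_range (V ∘L C - ContinuousLinearMap.id ℂ E)
  have h2 : IsCompactOperator (ContinuousLinearMap.id ℂ E) := by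
    have h3 : IsCompactOperator ((V ∘L C) - (V ∘L C - ContinuousLinearMap.id ℂ E) : E →L[ℂ] E) :=
      (hC.clm_comp V).sub h1
    rwa [sub_sub_cancel] at h3
  exact hE (FiniteDimensional.of_isCompactOperator_id (𝕜 := ℂ) h2)

/-- A self-adjoint operator which is a compact perturbation of `a` differs from `μ ≠ a` by a
Fredholm operator. -/
theorem isFredholm_sub_smul_of_isCompactOperator {E : Type u}
    [NormedAddCommGroup E] [InnerProductSpace ℂ E] [CompleteSpace E]
    {A : E →L[ℂ] E} (hA : IsSelfAdjoint A) {a μ : ℂ} (hμ : μ ≠ a)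
    (hC : IsCompactOperator (A - a • ContinuousLinearMap.id ℂ E)) :
    (A - μ • ContinuousLinearMap.id ℂ E).IsFredholm := by
  set C := A - a • ContinuousLinearMap.id ℂ E with hCdef
  set S := A - μ • ContinuousLinearMap.id ℂ E with hS
  have hν : μ - a ≠ 0 := sub_ne_zero.2 hμ
  have hSC : ∀ x, S x = C x - (μ - a) • x := fun x => by
    simp only [hS, hCdef, sub_apply, smul_apply,
      ContinuousLinearMap.id_apply]
    module
  set N := Module.End.eigenspace (C : Module.End ℂ E) (μ - a) with hN
  have hNfd : FiniteDimensional ℂ N := ContinuousLinearMap.finite_dimensional_eigenspace hC _ hν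
  have hNmem : ∀ x ∈ N, A x = μ • x := fun x hx => by
    have h1 : C x = (μ - a) • x := Module.End.mem_eigenspace_iff.1 hx
    have h2 := hSC x
    rw [h1, sub_self] at h2
    exact sub_eq_zero.1 h2
  -- Projection onto the kernel `N` of `S`. Adding it makes `S` invertible, and the inverse of `S +
  -- P` is a parametrix: both defects, `-V P` and `-P V`, have finite rank.
  let P : E →L[ℂ] E := N.starProjection
  have hPmem : ∀ x, P x ∈ N := fun x => N.starProjection_apply_mem x
  have hPr : P.toLinearMap.HasNoetherianRange := by
    have hle : P.toLinearMap.range ≤ N := by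
      rintro _ ⟨x, rfl⟩
      exact hPmem x
    exact isNoetherian_of_le hle
  have hPfd : FiniteDimensional ℂ P.range := Module.Finite.iff_fg.2 hPr.hasFiniteRange
  have hC' : IsCompactOperator (C + P : E →L[ℂ] E) :=
    hC.add (isCompactOperator_of_finiteDimensional_range P)
  have hnev : ¬ Module.End.HasEigenvalue ((C + P : E →L[ℂ] E) : Module.End ℂ E) (μ - a) := by
    intro h
    obtain ⟨x, hx⟩ := h.exists_hasEigenvector
    have hx1 : C x + P x = (μ - a) • x := hx.apply_eq_smul
    have hSP : S x = - P x := by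
      rw [hSC, ← hx1]; abel
    have hPx : ⟪P x, x⟫_ℂ = ⟪P x, P x⟫_ℂ := by
      rw [← sub_eq_zero, ← inner_sub_right]
      exact N.sub_starProjection_mem_orthogonal x _ (hPmem x)
    have hAP := hNmem _ (hPmem x)
    -- This covers non-real `μ` too, where it forces `P x = 0`; no case split on `μ` is needed.
    have h1 : (starRingEnd ℂ) μ * ⟪P x, P x⟫_ℂ = μ * ⟪P x, P x⟫_ℂ := by
      rw [← inner_smul_left, ← inner_smul_right, ← hAP]
      exact hA.isSymmetric (P x) (P x)
    have h2 : ⟪P x, S x⟫_ℂ = 0 := by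
      have h3 : S x = A x - μ • x := rfl
      have h4 : ⟪P x, A x⟫_ℂ = ⟪A (P x), x⟫_ℂ := (hA.isSymmetric (P x) x).symm
      rw [h3, inner_sub_right, h4, hAP, inner_smul_left, inner_smul_right, hPx, h1, sub_self]
    have h5 : P x = 0 := by
      rw [hSP, inner_neg_right, neg_eq_zero] at h2
      exact inner_self_eq_zero.1 h2
    rw [h5, add_zero] at hx1
    have h6 : x ∈ N := Module.End.mem_eigenspace_iff.2 hx1
    exact hx.2 (by rw [← N.starProjection_eq_self_iff.2 h6]; exact h5)
  have hres := (hC'.hasEigenvalue_or_mem_resolventSet hν).resolve_left hnev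
  rw [spectrum.mem_resolventSet_iff, ← IsUnit.neg_iff] at hres
  have hU : IsUnit (S + P) := by
    convert! hres using 1
    ext x
    simp only [add_apply, hSC, Algebra.algebraMap_eq_smul_one,
      neg_apply, sub_apply,
      smul_apply, one_apply_eq_self]
    abel
  obtain ⟨V, hVU⟩ := hU.exists_left_inv
  obtain ⟨W, hUW⟩ := hU.exists_right_inv
  have hUV : (S + P) * V = 1 := by rwa [left_inv_eq_right_inv hVU hUW]
  refine ContinuousLinearMap.IsFredholm.of_isQuasiInverse (v := V) ⟨?_, ?_⟩
  · refine LinearMap.FiniteRangeSetoid.equiv_iff_hasNoetherianRange.2 ?_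
    have : V.toLinearMap ∘ₗ S.toLinearMap - LinearMap.id = (-V.toLinearMap) ∘ₗ P.toLinearMap := by
      ext x
      have h := congrArg (fun f : E →L[ℂ] E => f x) hVU
      have h' : V (S x) + V (P x) = x := by rw [← map_add]; exact h
      change V (S x) - x = - V (P x)
      nth_rewrite 2 [← h']
      abel
    rw [this]
    exact hPr.comp_left _
  · refine LinearMap.FiniteRangeSetoid.equiv_iff_hasNoetherianRange.2 ?_
    have : S.toLinearMap ∘ₗ V.toLinearMap - LinearMap.id = P.toLinearMap ∘ₗ (-V.toLinearMap) := by
      ext x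
      have h' : S (V x) + P (V x) = x := congrArg (fun f : E →L[ℂ] E => f x) hUV
      change S (V x) - x = P (- V x)
      rw [map_neg]
      nth_rewrite 2 [← h']
      abel
    rw [this]
    exact hPr.comp_right _

/-- The essential spectrum of a self-adjoint compact perturbation of `a` is `{a}`. -/
theorem essentialSpectrum_eq_singleton {E : Type u}
    [NormedAddCommGroup E] [InnerProductSpace ℂ E] [CompleteSpace E]
    (hE : ¬ FiniteDimensional ℂ E) {A : E →L[ℂ] E} (hA : IsSelfAdjoint A) {a : ℂ}
    (hC : IsCompactOperator (A - a • ContinuousLinearMap.id ℂ E)) :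
    essentialSpectrum A = {a} := by
  ext μ
  simp only [essentialSpectrum, Set.mem_ofPred_eq, Set.mem_singleton_iff]
  constructor
  · intro h
    by_contra hμ
    exact h (isFredholm_sub_smul_of_isCompactOperator hA hμ hC)
  · rintro rfl
    exact not_isFredholm_of_isCompactOperator hE hC

/-! ### Compressions and the block operator -/

/-- The properties of a compression `J† T J` of `T = a + K - F` by an isometry `J`. -/
theorem isAbsolutelyNormAttaining_and_essentialSpectrum_of_compression {E : Type u} {H : Type v}
    [NormedAddCommGroup E] [InnerProductSpace ℂ E] [CompleteSpace E]
    [NormedAddCommGroup H] [InnerProductSpace ℂ H] [CompleteSpace H]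
    (hH : ¬ FiniteDimensional ℂ H) {K F : E →L[ℂ] E} {a : ℝ} (ha : 0 ≤ a) (hK : K.IsPositive)
    (hKc : IsCompactOperator K) [FiniteDimensional ℂ F.range]
    {A : H →L[ℂ] H} (hAs : IsSelfAdjoint A) (J : H →L[ℂ] E)
    (hJ : ContinuousLinearMap.adjoint J ∘L J = ContinuousLinearMap.id ℂ H)
    (hA : A = ContinuousLinearMap.adjoint J ∘L
      ((a : ℂ) • ContinuousLinearMap.id ℂ E + K - F) ∘L J) :
    IsAbsolutelyNormAttaining A ∧ essentialSpectrum A = {(a : ℂ)} := by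
  have hF : FiniteDimensional ℂ (ContinuousLinearMap.adjoint J ∘L F ∘L J).range := by
    have h : F.toLinearMap.HasNoetherianRange := inferInstanceAs (IsNoetherian ℂ F.range)
    exact Module.Finite.iff_fg.2
      ((h.comp_right J.toLinearMap).comp_left
        (ContinuousLinearMap.adjoint J).toLinearMap).hasFiniteRange
  have hKc' : IsCompactOperator (ContinuousLinearMap.adjoint J ∘L K ∘L J) :=
    (hKc.comp_clm J).clm_comp (ContinuousLinearMap.adjoint J)
  have hA' : A = (a : ℂ) • ContinuousLinearMap.id ℂ H
      + ContinuousLinearMap.adjoint J ∘L K ∘L J - ContinuousLinearMap.adjoint J ∘L F ∘L J := by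
    rw [hA, ← hJ]
    ext x
    simp
  refine ⟨isAbsolutelyNormAttaining_of_eq_smul_add_sub ha hAs (hK.adjoint_conj J) hKc' hA',
    essentialSpectrum_eq_singleton hH hAs ?_⟩
  rw [hA', add_sub_assoc, add_sub_cancel_left]
  exact hKc'.sub (isCompactOperator_of_finiteDimensional_range _)

theorem mainTheorem3 {H₁ : Type u} {H₂ : Type v}
    [NormedAddCommGroup H₁] [InnerProductSpace ℂ H₁] [CompleteSpace H₁]
    [TopologicalSpace.SeparableSpace H₁]
    [NormedAddCommGroup H₂] [InnerProductSpace ℂ H₂] [CompleteSpace H₂]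
    [TopologicalSpace.SeparableSpace H₂]
    (hH₁ : ¬ FiniteDimensional ℂ H₁) (hH₂ : ¬ FiniteDimensional ℂ H₂)
    (A₁ : H₁ →L[ℂ] H₁) (A₂ : H₂ →L[ℂ] H₂) (X : H₂ →L[ℂ] H₁)
    (hA₁ : A₁.IsPositive) (hA₂ : A₂.IsPositive)
    (hT : (blockOperator A₁ X (ContinuousLinearMap.adjoint X) A₂).IsPositive)
    (hAN : IsAbsolutelyNormAttaining
      (blockOperator A₁ X (ContinuousLinearMap.adjoint X) A₂)) :
    IsAbsolutelyNormAttaining A₁ ∧ IsAbsolutelyNormAttaining A₂ ∧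
      essentialSpectrum A₁ = essentialSpectrum A₂ ∧ IsCompactOperator X := by
  set T := blockOperator A₁ X (ContinuousLinearMap.adjoint X) A₂ with hTdef
  let J₁ : H₁ →L[ℂ] WithLp 2 (H₁ × H₂) :=
    (WithLp.prodContinuousLinearEquiv 2 ℂ H₁ H₂).symm.toContinuousLinearMap ∘L
      ContinuousLinearMap.inl ℂ H₁ H₂
  let J₂ : H₂ →L[ℂ] WithLp 2 (H₁ × H₂) :=
    (WithLp.prodContinuousLinearEquiv 2 ℂ H₁ H₂).symm.toContinuousLinearMap ∘L
      ContinuousLinearMap.inr ℂ H₁ H₂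
  have hJ₁ : ∀ z, ContinuousLinearMap.adjoint J₁ z = z.fst := fun z =>
    ext_inner_left ℂ fun x => by
      rw [ContinuousLinearMap.adjoint_inner_right, WithLp.prod_inner_apply]
      simp [J₁]
  have hJ₂ : ∀ z, ContinuousLinearMap.adjoint J₂ z = z.snd := fun z =>
    ext_inner_left ℂ fun x => by
      rw [ContinuousLinearMap.adjoint_inner_right, WithLp.prod_inner_apply]
      simp [J₂]
  have hE : ¬ FiniteDimensional ℂ (WithLp 2 (H₁ × H₂)) := fun h =>
    hH₁ (FiniteDimensional.of_injective J₁.toLinearMap fun x y hxy => by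
      have := congrArg (ContinuousLinearMap.adjoint J₁) hxy
      simpa [hJ₁, J₁] using this)
  obtain ⟨a, K, F, ha, hK, hKc, hF, hTeq⟩ :=
    exists_eq_smul_add_sub_of_isAbsolutelyNormAttaining hE hT hAN
  obtain ⟨h1, h1'⟩ := isAbsolutelyNormAttaining_and_essentialSpectrum_of_compression hH₁ ha hK hKc
    (F := F) hA₁.isSelfAdjoint J₁ (by ext x; simp [hJ₁, J₁]) (by
      rw [← hTeq]; ext x; simp [hJ₁, J₁, hTdef, blockOperator])
  obtain ⟨h2, h2'⟩ := isAbsolutelyNormAttaining_and_essentialSpectrum_of_compression hH₂ ha hK hKc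
    (F := F) hA₂.isSelfAdjoint J₂ (by ext x; simp [hJ₂, J₂]) (by
      rw [← hTeq]; ext x; simp [hJ₂, J₂, hTdef, blockOperator])
  refine ⟨h1, h2, h1'.trans h2'.symm, ?_⟩
  -- `J₁†` and `J₂` pick out the off-diagonal corner, where the scalar part `a` contributes nothing.
  have hX : X = ContinuousLinearMap.adjoint J₁ ∘L (K - F) ∘L J₂ := by
    have h : K - F = T - (a : ℂ) • ContinuousLinearMap.id ℂ _ := by rw [hTeq]; abel
    rw [h]
    ext x
    simp [hJ₁, J₂, hTdef, blockOperator]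
  rw [hX]
  exact ((hKc.sub (isCompactOperator_of_finiteDimensional_range F)).comp_clm J₂).clm_comp
    (ContinuousLinearMap.adjoint J₁)
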